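/- Let $n\ge 0$, $\ell\ge 1$ and $k\ge 0$ be integers, let $\epsilon\in\mathbb C$ be a primitive $\ell$-th root of unity, and let $c=(c_1,\dots,c_{\ell-1})\in\mathbb C^{\ell-1}$. Put $C_0=\frac{1-\ell}{\ell}-\frac1\ell\sum_{m=1}^{\ell-1}c_m$ and $C_i=\frac1\ell-\frac1\ell\sum_{m=1}^{\ell-1}\epsilon^{mi}c_m$ for $1\le i\le \ell-1$, and assume that $C_i\in\mathbb Z$ for all $i$. Let $\mathbf K_n=U(n)^{\ell}$, with elements $g=(g_0,\dots,g_{\ell-1})$, indices taken modulo $\ell$. Let $W_k\subset\mathbb C[y_1,\dots,y_n]$ be the space of homogeneous polynomials of degree $kn$, and let $W_{k,c}$ be the representation of $\mathbf K_n$ on $W_k$ in which $$ (g\cdot p)(y_1,\dots,y_n)=\Big(\prod_{i=0}^{\ell-1}\det(g_i)^{C_i}\Big)\det(g_0)^{-k}\;p\Big(\sum_i (g_0)_{i1}y_i,\dots,\sum_i (g_0)_{in}y_i\Big). $$ Let $W_{k,c}^\vee$ be the dual representation. Let $\mathbf K_n$ act on tuples $B=(B_0,\dots,B_{\ell-1})$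 of complex $n\times n$ matrices (representations of the cyclic quiver with arrows $V_i\to V_{i+1}$) by $(g\cdot B)_i=g_{i+1}B_ig_i^{-1}$. For $\lambda\in\mathbb C^n$ let $\mathcal O_\lambda$ be the $\mathbf K_n$-orbit of $\Delta^{op}(\lambda)=(\mathrm{diag}(\lambda),\dots,\mathrm{diag}(\lambda))$, and equip it with the measure that is the image of a Haar measure of $\mathbf K_n$ under $g\mapsto g\cdot\Delta^{op}(\lambda)$. Then $\mathbf K_n$ acts on $L^2(\mathcal O_\lambda)$ by $(g\cdot f)(B)=f(g^{-1}\cdot B)$. Suppose that $\lambda\in\Lambda^{reg}$, that is, $\lambda_i\neq0$ for all $i$ and $\lambda_i^\ell\ne\lambda_j^\ell$ for all $i\neq j$. Then there is an injective $\mathbf K_n$-equivariant linear map $\eta: W_{k,c}^\vee\to L^2(\mathcal O_\lambda)$, and it is unique up to scaling: every $\mathbf K_n$-equivariant linear map $W_{k,c}^\vee\to L^2(\mathcal O_\lambda)$ is a scalar multiple of $\eta$. -/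

import Mathlib

noncomputable section

namespace CyclicQuiver

open MeasureTheory MvPolynomial

/-- The compact group `K_n = U(n)^ℓ`. Vertices of the cyclic quiver are indexed by `Fin ℓ`, whose
addition is modulo `ℓ`. -/
abbrev KGroup (n ℓ : ℕ) : Type := Fin ℓ → Matrix.unitaryGroup (Fin n) ℂ

/-- `K_n` carries its Borel `σ`-algebra. -/
instance instMeasurableSpaceKGroup (n ℓ : ℕ) : MeasurableSpace (KGroup n ℓ) := borel _

instance instBorelSpaceKGroup (n ℓ : ℕ) : BorelSpace (KGroup n ℓ) := ⟨rfl⟩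

/-- Representations of dimension vector `(n, …, n)` of the opposite cyclic quiver:
`B i` is the matrix of the arrow `V_i → V_{i+1}`. -/
def RQop (n ℓ : ℕ) : Type := Fin ℓ → Matrix (Fin n) (Fin n) ℂ

instance instTopologicalSpaceRQop (n ℓ : ℕ) : TopologicalSpace (RQop n ℓ) :=
  inferInstanceAs (TopologicalSpace (Fin ℓ → Matrix (Fin n) (Fin n) ℂ))

/-- `RQop` carries its Borel `σ`-algebra; subsets carry the induced one. -/
instance instMeasurableSpaceRQop (n ℓ : ℕ) : MeasurableSpace (RQop n ℓ) := borel _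

instance instBorelSpaceRQop (n ℓ : ℕ) : BorelSpace (RQop n ℓ) := ⟨rfl⟩

/-- The action of `K_n` by change of basis: `(g · B)_i = g_{i+1} B_i g_i⁻¹`. -/
instance instMulActionRQop (n ℓ : ℕ) [NeZero ℓ] : MulAction (KGroup n ℓ) (RQop n ℓ) where
  smul g B := fun i =>
    (g (i + 1) : Matrix (Fin n) (Fin n) ℂ) * B i * ((g i)⁻¹ : Matrix.unitaryGroup (Fin n) ℂ)
  one_smul B := by
    funext i
    change ((1 : KGroup n ℓ) (i + 1) : Matrix (Fin n) (Fin n) ℂ) * B i *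
      (((1 : KGroup n ℓ) i)⁻¹ : Matrix.unitaryGroup (Fin n) ℂ) = B i
    simp
  mul_smul g h B := by
    funext i
    change ((g * h) (i + 1) : Matrix (Fin n) (Fin n) ℂ) * B i *
      (((g * h) i)⁻¹ : Matrix.unitaryGroup (Fin n) ℂ) =
      (g (i + 1) : Matrix (Fin n) (Fin n) ℂ) * ((h (i + 1) : Matrix (Fin n) (Fin n) ℂ) * B i *
        ((h i)⁻¹ : Matrix.unitaryGroup (Fin n) ℂ)) * ((g i)⁻¹ : Matrix.unitaryGroup (Fin n) ℂ)
    rw [Pi.mul_apply, Pi.mul_apply, mul_inv_rev, Submonoid.coe_mul, Submonoid.coe_mul]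
    simp only [Matrix.mul_assoc]

instance instContinuousSMulRQop (n ℓ : ℕ) [NeZero ℓ] :
    ContinuousSMul (KGroup n ℓ) (RQop n ℓ) where
  continuous_smul := by
    refine continuous_pi fun i => ?_
    change Continuous fun p : KGroup n ℓ × RQop n ℓ =>
      (p.1 (i + 1) : Matrix (Fin n) (Fin n) ℂ) * p.2 i *
        ((p.1 i)⁻¹ : Matrix.unitaryGroup (Fin n) ℂ)
    have h1 : Continuous fun p : KGroup n ℓ × RQop n ℓ =>
        (p.1 (i + 1) : Matrix (Fin n) (Fin n) ℂ) :=
      continuous_subtype_val.comp ((continuous_apply (i + 1)).comp continuous_fst)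
    have h2 : Continuous fun p : KGroup n ℓ × RQop n ℓ => p.2 i :=
      (continuous_apply (A := fun _ : Fin ℓ => Matrix (Fin n) (Fin n) ℂ) i).comp continuous_snd
    have h3 : Continuous fun p : KGroup n ℓ × RQop n ℓ =>
        (((p.1 i)⁻¹ : Matrix.unitaryGroup (Fin n) ℂ) : Matrix (Fin n) (Fin n) ℂ) :=
      continuous_subtype_val.comp (((continuous_apply i).comp continuous_fst).inv)
    exact (h1.matrix_mul h2).matrix_mul h3

/-- `Δ^op(y) = (diag(y), …, diag(y))`. -/
def DeltaOp (n ℓ : ℕ) (y : Fin n → ℂ) : RQop n ℓ := fun _ => Matrix.diagonal y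

/-- `Λ^reg`: all `λ_i` are non-zero and their `ℓ`-th powers are pairwise distinct. -/
def LambdaReg (n ℓ : ℕ) : Set (Fin n → ℂ) :=
  {y | (∀ i, y i ≠ 0) ∧ ∀ i j, i ≠ j → y i ^ ℓ ≠ y j ^ ℓ}

/-- The orbit `O_λ = K_n · Δ^op(λ)`. -/
abbrev Orbit (n ℓ : ℕ) [NeZero ℓ] (y : Fin n → ℂ) : Type :=
  MulAction.orbit (KGroup n ℓ) (DeltaOp n ℓ y)

/-- The orbit map `K_n → O_λ`, `g ↦ g · Δ^op(λ)`. -/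
def orbitMap (n ℓ : ℕ) [NeZero ℓ] (y : Fin n → ℂ) (g : KGroup n ℓ) : Orbit n ℓ y :=
  ⟨g • DeltaOp n ℓ y, MulAction.mem_orbit _ g⟩

/-- The measure `μ_λ` on `O_λ` induced by an invariant measure `μ` on `K_n`. -/
def orbitMeasure (n ℓ : ℕ) [NeZero ℓ] (μ : Measure (KGroup n ℓ)) (y : Fin n → ℂ) :
    Measure (Orbit n ℓ y) :=
  μ.map (orbitMap n ℓ y)

theorem measurable_orbitMap (n ℓ : ℕ) [NeZero ℓ] (y : Fin n → ℂ) :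
    Measurable (orbitMap n ℓ y) := by
  have h : Continuous (orbitMap n ℓ y) :=
    Continuous.subtype_mk (continuous_id.smul continuous_const) _
  exact h.measurable

theorem measurePreserving_orbit (n ℓ : ℕ) [NeZero ℓ] (μ : Measure (KGroup n ℓ))
    [μ.IsHaarMeasure] (y : Fin n → ℂ) (g : KGroup n ℓ) :
    MeasurePreserving (fun B : Orbit n ℓ y => g • B) (orbitMeasure n ℓ μ y)
      (orbitMeasure n ℓ μ y) := by
  have hg : Measurable (fun B : Orbit n ℓ y => g • B) := by
    have h0 : Continuous (fun B : Orbit n ℓ y => g • (B : RQop n ℓ)) :=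
      (continuous_const_smul g).comp continuous_subtype_val
    have h : Continuous (fun B : Orbit n ℓ y => g • B) :=
      h0.subtype_mk fun B => (g • B).2
    exact h.measurable
  have hl : Measurable (fun h : KGroup n ℓ => g * h) :=
    (continuous_const.mul continuous_id).measurable
  refine ⟨hg, ?_⟩
  have hcomp : (fun B : Orbit n ℓ y => g • B) ∘ orbitMap n ℓ y =
      orbitMap n ℓ y ∘ fun h => g * h := by
    funext h
    exact Subtype.ext (mul_smul g h (DeltaOp n ℓ y)).symm
  unfold orbitMeasure
  rw [Measure.map_map hg (measurable_orbitMap n ℓ y), hcomp,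
    ← Measure.map_map (measurable_orbitMap n ℓ y) hl, map_mul_left_eq_self]

/-- The representation of `K_n` on `L²(O_λ)`: `(g · f)(B) = f(g⁻¹ · B)`. -/
def orbitL2Rep (n ℓ : ℕ) [NeZero ℓ] (μ : Measure (KGroup n ℓ)) [μ.IsHaarMeasure]
    (y : Fin n → ℂ) : Representation ℂ (KGroup n ℓ) (Lp ℂ 2 (orbitMeasure n ℓ μ y)) where
  toFun g := Lp.compMeasurePreservingₗ ℂ (fun B : Orbit n ℓ y => g⁻¹ • B)
    (measurePreserving_orbit n ℓ μ y g⁻¹)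
  map_one' := by
    ext1 f
    apply Lp.ext
    refine (Lp.coeFn_compMeasurePreserving f _).trans ?_
    simp [Function.comp_def]
  map_mul' g h := by
    ext1 f
    apply Lp.ext
    refine (Lp.coeFn_compMeasurePreserving f _).trans ?_
    refine Filter.EventuallyEq.trans ?_ (Lp.coeFn_compMeasurePreserving _ _).symm
    refine Filter.EventuallyEq.trans ?_
      ((measurePreserving_orbit n ℓ μ y g⁻¹).quasiMeasurePreserving.ae_eq_comp
        (Lp.coeFn_compMeasurePreserving f (measurePreserving_orbit n ℓ μ y h⁻¹)).symm)
    simp [Function.comp_def, mul_smul]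

/-- The space `W_k ⊆ ℂ[y_1, …, y_n]` of homogeneous polynomials of degree `kn`. -/
abbrev W (n k : ℕ) : Submodule ℂ (MvPolynomial (Fin n) ℂ) :=
  homogeneousSubmodule (Fin n) ℂ (k * n)

/-- The linear substitution `y_j ↦ ∑ i, a_{ij} y_i`. It identifies `ℂ[y_1, …, y_n]` with the
symmetric algebra of `V_0 = ℂ^n`, with standard basis `y_1, …, y_n`. -/
def substHom (n : ℕ) (a : Matrix (Fin n) (Fin n) ℂ) :
    MvPolynomial (Fin n) ℂ →ₐ[ℂ] MvPolynomial (Fin n) ℂ :=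
  aeval fun j => ∑ i, C (a i j) * X i

theorem substHom_one (n : ℕ) : substHom n 1 = AlgHom.id ℂ _ := by
  apply MvPolynomial.algHom_ext
  intro j
  simp [substHom, Matrix.one_apply, apply_ite C, ite_mul]

theorem substHom_mul (n : ℕ) (a b : Matrix (Fin n) (Fin n) ℂ) :
    substHom n (a * b) = (substHom n a).comp (substHom n b) := by
  apply MvPolynomial.algHom_ext
  intro j
  simp only [substHom, aeval_X, AlgHom.comp_apply, map_sum, map_mul, Matrix.mul_apply,
    algHom_C, algebraMap_eq, Finset.sum_mul, Finset.mul_sum]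
  rw [Finset.sum_comm]
  refine Finset.sum_congr rfl fun i _ => Finset.sum_congr rfl fun l _ => ?_
  ring

theorem substHom_mem (n k : ℕ) (a : Matrix (Fin n) (Fin n) ℂ) :
    ∀ p ∈ W n k, (substHom n a).toLinearMap p ∈ W n k := by
  intro p hp
  have hp' : p.IsHomogeneous (k * n) := hp
  have h := hp'.aeval (fun j => ∑ i, C (a i j) * X i) (n := 1) fun j =>
    IsHomogeneous.sum _ _ _ fun i _ => isHomogeneous_C_mul_X (a i j) i
  rw [one_mul] at h
  exact h

/-- The representation `ρ_k` of `U(n)` on `W_k`: the action `Sym^{kn}(ℂ^n) ⊗ det^{-k}`. Scalar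
matrices act trivially, so this is the action of `PU(n)` integrating the
representation of `sl_n` on `W_k` in which `E_{ij}` acts as `y_i ∂/∂y_j`. -/
def rhoK (n k : ℕ) : Representation ℂ (Matrix.unitaryGroup (Fin n) ℂ) (W n k) where
  toFun g := ((g : Matrix (Fin n) (Fin n) ℂ).det ^ (-(k : ℤ))) •
    (substHom n (g : Matrix (Fin n) (Fin n) ℂ)).toLinearMap.restrict
      (substHom_mem n k (g : Matrix (Fin n) (Fin n) ℂ))
  map_one' := by
    ext1 p
    apply Subtype.ext
    simp [LinearMap.restrict_apply, substHom_one]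
  map_mul' g h := by
    ext1 p
    apply Subtype.ext
    simp [LinearMap.restrict_apply, substHom_mul, smul_smul, mul_pow, mul_comm]

/-- The character `χ` of `K_n` with differential `x ↦ ∑ i, C_i Tr(x_i)`. -/
def chiC (n ℓ : ℕ) (C : Fin ℓ → ℤ) : KGroup n ℓ →* ℂ where
  toFun g := ∏ i, (g i : Matrix (Fin n) (Fin n) ℂ).det ^ C i
  map_one' := by simp
  map_mul' g h := by simp [mul_zpow, Finset.prod_mul_distrib]

/-- The representation `W_{k,c} = ρ_k ⊗ χ_c` of `K_n` on the space `W_k`, where `ρ_k` is pulled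
back along the projection `g ↦ g_0`. -/
def rhoKC (n ℓ : ℕ) [NeZero ℓ] (k : ℕ) (C : Fin ℓ → ℤ) :
    Representation ℂ (KGroup n ℓ) (W n k) where
  toFun g := chiC n ℓ C g • rhoK n k (g 0)
  map_one' := by simp
  map_mul' g h := by
    rw [map_mul, Pi.mul_apply, map_mul, smul_mul_smul_comm]

/-- The numbers `C_i` attached to the parameters `c_1, …, c_{ℓ-1}` (`c m` stands for `c_{m+1}`)
and to the primitive `ℓ`-th root of unity `ε`. -/
def paramC (ℓ : ℕ) [NeZero ℓ] (ε : ℂ) (c : Fin (ℓ - 1) → ℂ) (i : Fin ℓ) : ℂ :=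
  (if i = 0 then (1 - (ℓ : ℂ)) / ℓ else 1 / ℓ) -
    1 / (ℓ : ℂ) * ∑ m : Fin (ℓ - 1), ε ^ (((m : ℕ) + 1) * (i : ℕ)) * c m

end CyclicQuiver

end

noncomputable section

namespace CyclicQuiver

open MeasureTheory MvPolynomial

/-! ### Substitution by diagonal matrices -/

/-! This is Frobenius reciprocity. For regular `λ` the stabilizer of `Δ^op(λ)` is the diagonal torus
`T` of `U(n)`, embedded in `K_n` as constant tuples, so `O_λ = K_n / T` and the equivariant maps
`W_{k,c}^∨ → L²(O_λ)` correspond to `T`-fixed vectors of `W_{k,c}`. Since `∑ C_i = 0`, the character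
`χ` is trivial on `T`; what is left is the zero weight space of `Sym^{kn} ⊗ det^{-k}`, the line
spanned by `v = (y_1 ⋯ y_n)^k`.

The vector `v` gives `η φ (g · Δ^op(λ)) = φ(g · v)`, which is injective because the translates of
`v` span `W_k` (`W_le_of_prodPow_mem`). Conversely, any equivariant map has the form `φ ↦ φ(x · w)`
almost everywhere on `K_n`, because left translation is ergodic (`exists_ae_eq_dual_rhoKC`). Right
invariance under `T` then makes `w` a multiple of `v`. -/

theorem substHom_C (n : ℕ) (a : Matrix (Fin n) (Fin n) ℂ) (z : ℂ) :
    substHom n a (C z) = C z := by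
  simp [substHom]

theorem substHom_X (n : ℕ) (a : Matrix (Fin n) (Fin n) ℂ) (j : Fin n) :
    substHom n a (X j) = ∑ i, C (a i j) * X i := by
  simp [substHom]

theorem substHom_diagonal_monomial {n : ℕ} (t : Fin n → ℂ) (s : Fin n →₀ ℕ) (z : ℂ) :
    substHom n (Matrix.diagonal t) (monomial s z) =
      monomial s ((s.prod fun i m => t i ^ m) * z) := by
  have hX (j : Fin n) : substHom n (Matrix.diagonal t) (X j) = C (t j) * X j := by
    simp [substHom, Matrix.diagonal_apply, apply_ite C, ite_mul]
  rw [monomial_eq, map_mul, substHom_C, Finsupp.prod, map_prod, monomial_eq, C_mul,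
    Finsupp.prod, Finsupp.prod, map_prod]
  simp only [map_pow, hX, mul_pow, Finset.prod_mul_distrib]
  ring

theorem coeff_substHom_diagonal {n : ℕ} (t : Fin n → ℂ) (p : MvPolynomial (Fin n) ℂ)
    (s : Fin n →₀ ℕ) :
    coeff s (substHom n (Matrix.diagonal t) p) = (s.prod fun i m => t i ^ m) * coeff s p := by
  induction p using MvPolynomial.induction_on' with
  | monomial u a =>
    rw [substHom_diagonal_monomial, coeff_monomial, coeff_monomial]
    split_ifs with h
    · rw [h]
    · simp
  | add p q hp hq => rw [map_add, coeff_add, coeff_add, hp, hq, mul_add]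

/-- Through `funext_set` this makes the compact torus Zariski dense: a polynomial identity need only
be checked at unitary arguments. -/
theorem infinite_unitary_complex : (unitary ℂ : Set ℂ).Infinite := by
  have h : (unitary ℂ : Set ℂ) = Metric.sphere 0 1 := by
    ext z
    rw [SetLike.mem_coe, Unitary.mem_iff_self_mul_star, mem_sphere_zero_iff_norm,
      Complex.star_def, Complex.mul_conj, Complex.normSq_eq_norm_sq, Complex.ofReal_eq_one]
    exact pow_eq_one_iff_of_nonneg (norm_nonneg z) two_ne_zero
  rw [h]
  refine (isPreconnected_sphere (by simp [Complex.rank_real_complex]) 0 1).infinite_of_nontrivial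
    ⟨1, by simp, -1, by simp, ?_⟩
  norm_num [Complex.ext_iff]

/-- The diagonal unitary matrix with given entries. -/
def diagUnitary {n : ℕ} (t : Fin n → ℂ) (ht : ∀ i, t i ∈ unitary ℂ) :
    Matrix.unitaryGroup (Fin n) ℂ :=
  ⟨Matrix.diagonal t, by
    rw [Matrix.mem_unitaryGroup_iff, Matrix.star_eq_conjTranspose, Matrix.diagonal_conjTranspose,
      Matrix.diagonal_mul_diagonal, ← Matrix.diagonal_one]
    congr 1
    funext i
    exact (Unitary.mem_iff.1 (ht i)).2⟩

/-- A subspace stable under the diagonal torus contains the monomials of its elements. -/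
theorem monomial_mem_of_torus_stable {n : ℕ} (S : Submodule ℂ (MvPolynomial (Fin n) ℂ))
    (hS : ∀ t : Fin n → ℂ, (∀ i, t i ∈ unitary ℂ) →
      ∀ p ∈ S, substHom n (Matrix.diagonal t) p ∈ S)
    {p : MvPolynomial (Fin n) ℂ} (hp : p ∈ S) (s : Fin n →₀ ℕ) :
    monomial s (coeff s p) ∈ S := by
  by_contra hs
  obtain ⟨f, hf, hSf⟩ := Submodule.exists_le_ker_of_notMem hs
  -- The value of this polynomial at a torus point `t` is `f (t · p)`, which vanishes because `f`
  -- kills `S`.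
  have hq : (∑ u ∈ p.support, monomial u (f (monomial u (coeff u p)))) =
      (0 : MvPolynomial (Fin n) ℂ) := by
    refine funext_set (fun _ => (unitary ℂ : Set ℂ)) (fun _ => infinite_unitary_complex)
      fun t ht => ?_
    have h0 : f (substHom n (Matrix.diagonal t) p) = 0 :=
      hSf (hS t (fun i => ht i trivial) p hp)
    rw [p.as_sum, map_sum, map_sum] at h0
    rw [map_sum, map_zero, ← h0]
    refine Finset.sum_congr rfl fun u _ => ?_
    rw [substHom_diagonal_monomial, eval_monomial, ← smul_eq_mul (_ : ℂ) (coeff u p),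
      ← smul_monomial, map_smul, smul_eq_mul, mul_comm]
  apply hf
  have h := congrArg (coeff s) hq
  rw [coeff_sum, coeff_zero] at h
  by_cases hsp : s ∈ p.support
  · rwa [Finset.sum_eq_single s, coeff_monomial, if_pos rfl] at h
    · intro u _ hu
      rw [coeff_monomial, if_neg hu]
    · exact fun h' => absurd hsp h'
  · rw [notMem_support_iff.1 hsp, monomial_zero, map_zero]

/-- Every diagonal matrix, singular ones included, scales monomials, and `S` contains the monomials
of its elements. -/
theorem substHom_diagonal_mem_of_torus_stable {n : ℕ} (S : Submodule ℂ (MvPolynomial (Fin n) ℂ))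
    (hS : ∀ t : Fin n → ℂ, (∀ i, t i ∈ unitary ℂ) →
      ∀ p ∈ S, substHom n (Matrix.diagonal t) p ∈ S)
    (t : Fin n → ℂ) {p : MvPolynomial (Fin n) ℂ} (hp : p ∈ S) :
    substHom n (Matrix.diagonal t) p ∈ S := by
  rw [p.as_sum, map_sum]
  refine S.sum_mem fun u _ => ?_
  rw [substHom_diagonal_monomial, ← smul_eq_mul, ← smul_monomial]
  exact S.smul_mem _ (monomial_mem_of_torus_stable S hS hp u)

/-! ### Irreducibility-type statement -/

/-- By the spectral theorem `a = U D U*` with `U` unitary and `D` diagonal, so unitary stability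
extends to Hermitian matrices, even non-invertible ones. -/
theorem substHom_mem_of_isHermitian {n : ℕ} (S : Submodule ℂ (MvPolynomial (Fin n) ℂ))
    (hS : ∀ g : Matrix.unitaryGroup (Fin n) ℂ, ∀ p ∈ S, substHom n g p ∈ S)
    {a : Matrix (Fin n) (Fin n) ℂ} (ha : a.IsHermitian) {p : MvPolynomial (Fin n) ℂ}
    (hp : p ∈ S) : substHom n a p ∈ S := by
  rw [ha.spectral_theorem, Unitary.conjStarAlgAut_apply, substHom_mul, substHom_mul]
  refine hS ha.eigenvectorUnitary _ (substHom_diagonal_mem_of_torus_stable S ?_ _ ?_)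
  · exact fun t ht q hq => hS (diagUnitary t ht) q hq
  · exact hS (star ha.eigenvectorUnitary) p hp

/-- The vector `(y_1 ⋯ y_n)^k`. -/
def prodPow (n k : ℕ) : MvPolynomial (Fin n) ℂ := ∏ i, X i ^ k

theorem prodPow_eq_monomial (n k : ℕ) :
    prodPow n k = monomial (Finsupp.equivFunOnFinite.symm fun _ => k) 1 := by
  rw [monomial_eq, C_1, one_mul, Finsupp.prod_fintype _ _ (by simp)]
  simp [prodPow]

theorem prodPow_mem (n k : ℕ) : prodPow n k ∈ W n k := by
  rw [prodPow_eq_monomial]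
  apply isHomogeneous_monomial
  simp [Finsupp.degree_eq_sum, mul_comm]

/-- A `U(n)`-stable subspace which contains `(y_1 ⋯ y_n)^k` contains `W_k`. -/
theorem W_le_of_prodPow_mem {n k : ℕ} (S : Submodule ℂ (MvPolynomial (Fin n) ℂ))
    (hS : ∀ g : Matrix.unitaryGroup (Fin n) ℂ, ∀ p ∈ S, substHom n g p ∈ S)
    (hk : prodPow n k ∈ S) : W n k ≤ S := by
  -- The all-ones matrix is Hermitian and sends every variable to `∑ y_i`. In the resulting power
  -- every monomial of degree `kn` has a nonzero multinomial coefficient.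
  have hJ : (∑ i, X i : MvPolynomial (Fin n) ℂ) ^ (k * n) ∈ S := by
    have h := substHom_mem_of_isHermitian S hS
      (a := Matrix.of fun _ _ => (1 : ℂ)) (by ext; simp) hk
    simpa [prodPow, substHom_X, ← pow_mul] using h
  intro p hp
  rw [p.as_sum]
  refine S.sum_mem fun u hu => ?_
  have h := monomial_mem_of_torus_stable S (fun t ht q hq => hS (diagUnitary t ht) q hq) hJ u
  have hdeg : (u.sum fun _ m => m) = k * n := by
    have := hp (mem_support_iff.1 hu)
    simpa [Finsupp.weight_apply] using this
  rw [coeff_sum_X_pow_of_fintype, if_pos hdeg] at h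
  have hne : (u.multinomial : ℂ) ≠ 0 := by
    rw [Nat.cast_ne_zero]
    exact (Nat.multinomial_pos _ _).ne'
  have h' := S.smul_mem (coeff u p * (u.multinomial : ℂ)⁻¹) h
  rwa [smul_monomial, smul_eq_mul, mul_assoc, inv_mul_cancel₀ hne, mul_one] at h'

/-- The weight space: polynomials on which a diagonal unitary matrix acts by `det ^ k`. -/
theorem exists_eq_smul_prodPow {n k : ℕ} {p : MvPolynomial (Fin n) ℂ}
    (hp : ∀ t : Fin n → ℂ, (∀ i, t i ∈ unitary ℂ) →
      substHom n (Matrix.diagonal t) p = (∏ i, t i) ^ k • p) :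
    ∃ a : ℂ, p = a • prodPow n k := by
  rw [prodPow_eq_monomial]
  set e : Fin n →₀ ℕ := Finsupp.equivFunOnFinite.symm fun _ => k with he
  refine ⟨coeff e p, ?_⟩
  ext s
  rw [coeff_smul, coeff_monomial]
  split_ifs with hs
  · simp [hs]
  rw [smul_zero]
  by_contra hc
  have h : monomial s (coeff s p) = monomial e (coeff s p) := by
    refine funext_set (fun _ => (unitary ℂ : Set ℂ)) (fun _ => infinite_unitary_complex)
      fun t ht => ?_
    have h := congrArg (coeff s) (hp t fun i => ht i trivial)
    rw [coeff_substHom_diagonal, coeff_smul, smul_eq_mul] at h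
    rw [eval_monomial, eval_monomial, mul_comm, h, mul_comm]
    congr 1
    rw [Finsupp.prod_fintype _ _ (by simp)]
    simp [he, Finset.prod_pow]
  have h2 := congrArg (coeff s) h
  rw [coeff_monomial, coeff_monomial, if_pos rfl, if_neg hs] at h2
  exact hc h2

/-! ### The integers `C_i` and the stabilizer -/

/-- The exponents `m + 1` run over `1, …, ℓ - 1`, so each `c m` is multiplied by a vanishing
geometric sum; the remaining terms are `1/ℓ - δ_{i0}`. -/
theorem sum_paramC (ℓ : ℕ) [NeZero ℓ] (ε : ℂ) (hε : IsPrimitiveRoot ε ℓ) (c : Fin (ℓ - 1) → ℂ) :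
    ∑ i, paramC ℓ ε c i = 0 := by
  have hℓ : (ℓ : ℂ) ≠ 0 := Nat.cast_ne_zero.2 (NeZero.ne ℓ)
  have hgeom (m : Fin (ℓ - 1)) : ∑ i : Fin ℓ, ε ^ (((m : ℕ) + 1) * (i : ℕ)) = 0 := by
    have hne : ε ^ ((m : ℕ) + 1) ≠ 1 := hε.pow_ne_one_of_pos_of_lt (by omega) (by omega)
    rw [Fin.sum_univ_eq_sum_range fun i => ε ^ (((m : ℕ) + 1) * i)]
    simp only [pow_mul]
    rw [geom_sum_eq hne, ← pow_mul, mul_comm, pow_mul, hε.pow_eq_one]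
    simp
  have h1 : ∑ i : Fin ℓ, (if i = 0 then (1 - (ℓ : ℂ)) / ℓ else 1 / ℓ) = 0 := by
    have h (i : Fin ℓ) : (if i = 0 then (1 - (ℓ : ℂ)) / ℓ else 1 / ℓ) =
        1 / ℓ - if i = 0 then 1 else 0 := by
      split_ifs <;> field_simp; ring
    simp only [h, Finset.sum_sub_distrib, Finset.sum_const, Finset.sum_ite_eq']
    simp [hℓ]
  simp only [paramC, Finset.sum_sub_distrib, h1, ← Finset.mul_sum]
  rw [Finset.sum_comm]
  simp [← Finset.sum_mul, hgeom]

theorem sum_eq_zero_of_eq_paramC {ℓ : ℕ} [NeZero ℓ] {ε : ℂ} (hε : IsPrimitiveRoot ε ℓ)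
    {c : Fin (ℓ - 1) → ℂ} {C : Fin ℓ → ℤ} (hC : ∀ i, (C i : ℂ) = paramC ℓ ε c i) :
    ∑ i, C i = 0 := by
  have h : ((∑ i, C i : ℤ) : ℂ) = 0 := by
    rw [Int.cast_sum, ← sum_paramC ℓ ε hε c]
    exact Finset.sum_congr rfl fun i _ => hC i
  exact_mod_cast h

theorem det_unitary_ne_zero {n : ℕ} (g : Matrix.unitaryGroup (Fin n) ℂ) :
    (g : Matrix (Fin n) (Fin n) ℂ).det ≠ 0 :=
  ((Matrix.isUnit_iff_isUnit_det _).1 (Unitary.toUnits g).isUnit).ne_zero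

theorem chiC_const {n ℓ : ℕ} {C : Fin ℓ → ℤ} (hC : ∑ i, C i = 0)
    (t : Matrix.unitaryGroup (Fin n) ℂ) : chiC n ℓ C (fun _ => t) = 1 := by
  change ∏ i, (t : Matrix (Fin n) (Fin n) ℂ).det ^ C i = 1
  have h (s : Finset (Fin ℓ)) : ∏ i ∈ s, (t : Matrix (Fin n) (Fin n) ℂ).det ^ C i =
      (t : Matrix (Fin n) (Fin n) ℂ).det ^ ∑ i ∈ s, C i := by
    induction s using Finset.cons_induction with
    | empty => simp
    | cons a s has ih =>
      rw [Finset.prod_cons, Finset.sum_cons, zpow_add₀ (det_unitary_ne_zero t), ih]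
  rw [h, hC, zpow_zero]

theorem rhoKC_apply_coe {n ℓ : ℕ} [NeZero ℓ] (k : ℕ) (C : Fin ℓ → ℤ) (g : KGroup n ℓ)
    (p : W n k) :
    (rhoKC n ℓ k C g p : MvPolynomial (Fin n) ℂ) =
      (chiC n ℓ C g * (g 0 : Matrix (Fin n) (Fin n) ℂ).det ^ (-(k : ℤ))) •
        substHom n (g 0 : Matrix (Fin n) (Fin n) ℂ) p := by
  rw [mul_smul]
  rfl

theorem smul_deltaOp_eq_iff {n ℓ : ℕ} [NeZero ℓ] (lam : Fin n → ℂ) (h : KGroup n ℓ) :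
    h • DeltaOp n ℓ lam = DeltaOp n ℓ lam ↔ ∀ i a b,
      (h (i + 1) : Matrix (Fin n) (Fin n) ℂ) a b * lam b =
        lam a * (h i : Matrix (Fin n) (Fin n) ℂ) a b := by
  have key (i : Fin ℓ) : (h • DeltaOp n ℓ lam) i = DeltaOp n ℓ lam i ↔
      (h (i + 1) : Matrix (Fin n) (Fin n) ℂ) * Matrix.diagonal lam =
        Matrix.diagonal lam * (h i : Matrix (Fin n) (Fin n) ℂ) := by
    change (h (i + 1) : Matrix (Fin n) (Fin n) ℂ) * Matrix.diagonal lam *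
      ((h i)⁻¹ : Matrix.unitaryGroup (Fin n) ℂ) = Matrix.diagonal lam ↔ _
    have h1 : (((h i)⁻¹ : Matrix.unitaryGroup (Fin n) ℂ) : Matrix (Fin n) (Fin n) ℂ) *
        (h i : Matrix (Fin n) (Fin n) ℂ) = 1 := by
      rw [← Submonoid.coe_mul, inv_mul_cancel, Submonoid.coe_one]
    have h2 : (h i : Matrix (Fin n) (Fin n) ℂ) *
        (((h i)⁻¹ : Matrix.unitaryGroup (Fin n) ℂ) : Matrix (Fin n) (Fin n) ℂ) = 1 := by
      rw [← Submonoid.coe_mul, mul_inv_cancel, Submonoid.coe_one]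
    constructor
    · intro h'
      conv_rhs => rw [← h']
      rw [Matrix.mul_assoc, h1, Matrix.mul_one]
    · intro h'
      rw [h', Matrix.mul_assoc, h2, Matrix.mul_one]
  rw [show h • DeltaOp n ℓ lam = DeltaOp n ℓ lam ↔
    ∀ i, (h • DeltaOp n ℓ lam) i = DeltaOp n ℓ lam i from funext_iff]
  refine forall_congr' fun i => (key i).trans ?_
  simp [← Matrix.ext_iff, Matrix.mul_diagonal, Matrix.diagonal_mul]

theorem const_diagUnitary_smul_deltaOp {n ℓ : ℕ} [NeZero ℓ] (lam t : Fin n → ℂ)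
    (ht : ∀ i, t i ∈ unitary ℂ) :
    (fun _ => diagUnitary t ht : KGroup n ℓ) • DeltaOp n ℓ lam = DeltaOp n ℓ lam := by
  rw [smul_deltaOp_eq_iff]
  intro i a b
  by_cases hab : a = b
  · rw [hab, mul_comm]
  · simp [diagUnitary, hab]

/-- For `λ ∈ Λ^reg` the stabilizer of `Δ^op(λ)` is the diagonal torus. -/
theorem exists_const_diagUnitary_of_smul_deltaOp {n ℓ : ℕ} [NeZero ℓ] {lam : Fin n → ℂ}
    (hlam : lam ∈ LambdaReg n ℓ) {h : KGroup n ℓ}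
    (hh : h • DeltaOp n ℓ lam = DeltaOp n ℓ lam) :
    ∃ (t : Fin n → ℂ) (ht : ∀ i, t i ∈ unitary ℂ), h = fun _ => diagUnitary t ht := by
  rw [smul_deltaOp_eq_iff] at hh
  -- The stabilizer equations are iterated along `j` arrows. At `j = ℓ` the walk returns to vertex
  -- `0` and gives `(λ_b^ℓ - λ_a^ℓ) (h_0)_{ab} = 0`.
  have hpow (a b : Fin n) (j : ℕ) :
      (h (Fin.ofNat ℓ j) : Matrix (Fin n) (Fin n) ℂ) a b * lam b ^ j =
        lam a ^ j * (h 0 : Matrix (Fin n) (Fin n) ℂ) a b := by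
    induction j with
    | zero =>
      simp
    | succ j ih =>
      have : Fin.ofNat ℓ (j + 1) = Fin.ofNat ℓ j + 1 := by
        ext; simp [Fin.val_add]
      rw [this, pow_succ', ← mul_assoc, hh, mul_assoc, ih]
      ring
  have hself (i : Fin ℓ) : Fin.ofNat ℓ (i : ℕ) = i := by
    ext; simp
  have hoff (i : Fin ℓ) (a b : Fin n) (hab : a ≠ b) :
      (h i : Matrix (Fin n) (Fin n) ℂ) a b = 0 := by
    have h0 : (h 0 : Matrix (Fin n) (Fin n) ℂ) a b = 0 := by
      have := hpow a b ℓ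
      rw [show Fin.ofNat ℓ ℓ = 0 by ext; simp, mul_comm, ← sub_eq_zero, ← sub_mul] at this
      exact (mul_eq_zero.1 this).resolve_left (sub_ne_zero.2 (hlam.2 b a hab.symm))
    have := hpow a b i
    rw [hself, h0, mul_zero] at this
    exact (mul_eq_zero.1 this).resolve_right (pow_ne_zero _ (hlam.1 b))
  have hdiag (i : Fin ℓ) (a : Fin n) :
      (h i : Matrix (Fin n) (Fin n) ℂ) a a = (h 0 : Matrix (Fin n) (Fin n) ℂ) a a := by
    have := hpow a a i
    rw [hself, mul_comm] at this
    exact mul_left_cancel₀ (pow_ne_zero _ (hlam.1 a)) this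
  have hmat (i : Fin ℓ) : (h i : Matrix (Fin n) (Fin n) ℂ) =
      Matrix.diagonal fun a => (h 0 : Matrix (Fin n) (Fin n) ℂ) a a := by
    ext a b
    by_cases hab : a = b
    · subst hab
      rw [Matrix.diagonal_apply_eq, hdiag]
    · rw [Matrix.diagonal_apply_ne _ hab, hoff i a b hab]
  refine ⟨fun a => (h 0 : Matrix (Fin n) (Fin n) ℂ) a a, fun a => ?_, ?_⟩
  · have h1 := Matrix.mem_unitaryGroup_iff.1 (h 0).2
    rw [hmat 0, Matrix.star_eq_conjTranspose, Matrix.diagonal_conjTranspose,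
      Matrix.diagonal_mul_diagonal] at h1
    have h2 := congrFun (congrFun h1 a) a
    simp only [Matrix.diagonal_apply_eq, Matrix.one_apply_eq] at h2
    exact Unitary.mem_iff_self_mul_star.2 h2
  · funext i
    exact Subtype.ext (hmat i)

/-- `(y_1 ⋯ y_n)^k` as an element of `W_k`. -/
def zeroWeight (n k : ℕ) : W n k := ⟨prodPow n k, prodPow_mem n k⟩

theorem rhoKC_const_diagUnitary_apply_coe {n ℓ : ℕ} [NeZero ℓ] (k : ℕ) {C : Fin ℓ → ℤ}
    (hC : ∑ i, C i = 0) (t : Fin n → ℂ) (ht : ∀ i, t i ∈ unitary ℂ) (p : W n k) :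
    (rhoKC n ℓ k C (fun _ => diagUnitary t ht) p : MvPolynomial (Fin n) ℂ) =
      (∏ i, t i) ^ (-(k : ℤ)) • substHom n (Matrix.diagonal t) p := by
  rw [rhoKC_apply_coe, chiC_const hC, one_mul]
  simp [diagUnitary]

theorem prod_unitary_ne_zero {n : ℕ} {t : Fin n → ℂ} (ht : ∀ i, t i ∈ unitary ℂ) :
    ∏ i, t i ≠ 0 :=
  Finset.prod_ne_zero_iff.2 fun i _ h0 => by
    have := Unitary.mul_star_self_of_mem (ht i)
    simp [h0] at this

theorem rhoKC_zeroWeight_of_smul_deltaOp {n ℓ : ℕ} [NeZero ℓ] (k : ℕ) {C : Fin ℓ → ℤ}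
    (hC : ∑ i, C i = 0) {lam : Fin n → ℂ} (hlam : lam ∈ LambdaReg n ℓ) {h : KGroup n ℓ}
    (hh : h • DeltaOp n ℓ lam = DeltaOp n ℓ lam) :
    rhoKC n ℓ k C h (zeroWeight n k) = zeroWeight n k := by
  obtain ⟨t, ht, rfl⟩ := exists_const_diagUnitary_of_smul_deltaOp hlam hh
  apply Subtype.ext
  rw [rhoKC_const_diagUnitary_apply_coe k hC]
  change _ • substHom n (Matrix.diagonal t) (prodPow n k) = prodPow n k
  rw [prodPow_eq_monomial, substHom_diagonal_monomial, smul_monomial, smul_eq_mul, mul_one,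
    Finsupp.prod_fintype _ _ (by simp)]
  simp only [Finsupp.equivFunOnFinite_symm_apply_apply, Finset.prod_pow, zpow_neg, zpow_natCast]
  rw [inv_mul_cancel₀ (pow_ne_zero k (prod_unitary_ne_zero ht))]

theorem exists_eq_smul_zeroWeight {n ℓ : ℕ} [NeZero ℓ] {k : ℕ} {C : Fin ℓ → ℤ}
    (hC : ∑ i, C i = 0) {w : W n k}
    (hw : ∀ (t : Fin n → ℂ) (ht : ∀ i, t i ∈ unitary ℂ),
      rhoKC n ℓ k C (fun _ => diagUnitary t ht) w = w) :
    ∃ a : ℂ, w = a • zeroWeight n k := by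
  obtain ⟨a, ha⟩ := exists_eq_smul_prodPow (n := n) (k := k) (p := w) fun t ht => by
    have h := congrArg Subtype.val (hw t ht)
    rw [rhoKC_const_diagUnitary_apply_coe k hC] at h
    conv_rhs => rw [← h]
    rw [smul_smul, zpow_neg, zpow_natCast,
      mul_inv_cancel₀ (pow_ne_zero k (prod_unitary_ne_zero ht)), one_smul]
  exact ⟨a, Subtype.ext ha⟩

/-- The translates of `(y_1 ⋯ y_n)^k` span `W_k`. -/
theorem eq_zero_of_forall_rhoKC_zeroWeight {n ℓ : ℕ} [NeZero ℓ] {k : ℕ} {C : Fin ℓ → ℤ}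
    {φ : Module.Dual ℂ (W n k)} (hφ : ∀ g, φ (rhoKC n ℓ k C g (zeroWeight n k)) = 0) :
    φ = 0 := by
  let S : Submodule ℂ (MvPolynomial (Fin n) ℂ) :=
    -- The largest `K_n`-stable subspace of `ker φ`, viewed among all polynomials.
    (⨅ g, (φ ∘ₗ rhoKC n ℓ k C g).ker).map (W n k).subtype
  have hmem (p : W n k) : (p : MvPolynomial (Fin n) ℂ) ∈ S ↔ ∀ g, φ (rhoKC n ℓ k C g p) = 0 := by
    simp [S, Submodule.mem_iInf]
  have hle : W n k ≤ S := by
    refine W_le_of_prodPow_mem S ?_ ((hmem (zeroWeight n k)).2 hφ)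
    intro g p hp
    obtain ⟨p, -, rfl⟩ := id hp
    rw [Submodule.subtype_apply] at hp ⊢
    have h := (hmem p).1 hp
    -- The constant tuple at `g` acts as `substHom n g` up to a nonzero scalar.
    have h2 : (rhoKC n ℓ k C (fun _ => g) p : MvPolynomial (Fin n) ℂ) ∈ S := by
      rw [hmem]
      intro g'
      have := h (g' * fun _ => g)
      rwa [map_mul] at this
    rw [rhoKC_apply_coe] at h2
    refine (S.smul_mem_iff (mul_ne_zero ?_ (zpow_ne_zero _ (det_unitary_ne_zero g)))).1 h2
    change ∏ i, (g : Matrix (Fin n) (Fin n) ℂ).det ^ C i ≠ 0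
    exact Finset.prod_ne_zero_iff.2 fun i _ => zpow_ne_zero _ (det_unitary_ne_zero g)
  ext p
  simpa using (hmem p).1 (hle p.2) 1

/-! ### Topology of `K_n` and continuity of matrix coefficients -/

instance instCompactSpaceUnitaryGroup (n : ℕ) : CompactSpace (Matrix.unitaryGroup (Fin n) ℂ) := by
  have hbox : IsCompact (X := Matrix (Fin n) (Fin n) ℂ)
      (Set.pi Set.univ fun _ => Set.pi Set.univ fun _ => Metric.closedBall (0 : ℂ) 1) :=
    isCompact_univ_pi fun _ => isCompact_univ_pi fun _ => isCompact_closedBall 0 1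
  have hclosed : IsClosed (unitary (Matrix (Fin n) (Fin n) ℂ) : Set (Matrix (Fin n) (Fin n) ℂ)) :=
    isClosed_unitary
  refine isCompact_iff_compactSpace.1 (hbox.of_isClosed_subset hclosed ?_)
  intro U hU i _ j _
  simpa using entry_norm_bound_of_unitary hU i j

instance instSecondCountableTopologyUnitaryGroup (n : ℕ) :
    SecondCountableTopology (Matrix.unitaryGroup (Fin n) ℂ) :=
  haveI : SecondCountableTopology (Matrix (Fin n) (Fin n) ℂ) :=
    inferInstanceAs (SecondCountableTopology (Fin n → Fin n → ℂ))
  TopologicalSpace.Subtype.secondCountableTopology _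

instance instT2SpaceRQop (n ℓ : ℕ) : T2Space (RQop n ℓ) :=
  inferInstanceAs (T2Space (Fin ℓ → Fin n → Fin n → ℂ))

/-- The functional varies in the induction so that a factor `X i` can be absorbed into it. -/
theorem continuous_dual_substHom {n : ℕ} (p : MvPolynomial (Fin n) ℂ)
    (f : MvPolynomial (Fin n) ℂ →ₗ[ℂ] ℂ) : Continuous fun a => f (substHom n a p) := by
  induction p using MvPolynomial.induction_on generalizing f with
  | C z => simpa only [substHom_C] using continuous_const
  | add p q hp hq => simpa only [map_add] using! (hp f).add (hq f)
  | mul_X p j hp =>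
    have h (a : Matrix (Fin n) (Fin n) ℂ) : f (substHom n a (p * X j)) =
        ∑ i, a i j * (f ∘ₗ LinearMap.mulRight ℂ (X i)) (substHom n a p) := by
      rw [map_mul, substHom_X, Finset.mul_sum, map_sum]
      refine Finset.sum_congr rfl fun i _ => ?_
      rw [mul_left_comm, ← smul_eq_C_mul, map_smul, smul_eq_mul, LinearMap.comp_apply,
        LinearMap.mulRight_apply]
    simp only [h]
    exact continuous_finsetSum _ fun i _ =>
      (continuous_id.matrix_elem i j).mul (hp _)

theorem continuous_zpow_det_unitary (n : ℕ) (m : ℤ) :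
    Continuous fun g : Matrix.unitaryGroup (Fin n) ℂ => (g : Matrix (Fin n) (Fin n) ℂ).det ^ m :=
  continuous_subtype_val.matrix_det.zpow₀ m fun g => Or.inl (det_unitary_ne_zero g)

theorem continuous_dual_rhoKC {n ℓ : ℕ} [NeZero ℓ] (k : ℕ) (C : Fin ℓ → ℤ)
    (φ : Module.Dual ℂ (W n k)) (p : W n k) :
    Continuous fun g => φ (rhoKC n ℓ k C g p) := by
  obtain ⟨f, rfl⟩ := LinearMap.exists_extend φ
  simp only [LinearMap.comp_apply, Submodule.subtype_apply, rhoKC_apply_coe, map_smul,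
    smul_eq_mul]
  refine Continuous.mul (Continuous.mul ?_ ?_) ?_
  · change Continuous fun g : KGroup n ℓ => ∏ i, (g i : Matrix (Fin n) (Fin n) ℂ).det ^ C i
    exact continuous_finsetProd _ fun i _ =>
      (continuous_zpow_det_unitary n (C i)).comp (continuous_apply i)
  · exact (continuous_zpow_det_unitary n _).comp (continuous_apply 0)
  · exact (continuous_dual_substHom _ f).comp
      (continuous_subtype_val.comp (continuous_apply 0))

/-- Left translation is ergodic, so each preimage of a measurable set is null or conull; measurable
sets separate points of `ℂ` countably. The exceptional null set may depend on `g`. -/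
theorem exists_ae_eq_const_of_forall_mul_left {n ℓ : ℕ} (μ : Measure (KGroup n ℓ))
    [μ.IsHaarMeasure] {f : KGroup n ℓ → ℂ} (hf : Measurable f)
    (hinv : ∀ g, ∀ᵐ x ∂μ, f (g * x) = f x) : ∃ a : ℂ, ∀ᵐ x ∂μ, f x = a := by
  refine Filter.exists_eventuallyEq_const_of_forall_separating MeasurableSet fun U hU => ?_
  have h := aeconst_of_forall_preimage_smul_ae_eq (KGroup n ℓ) (μ := μ) (s := f ⁻¹' U)
    (hf hU).nullMeasurableSet fun g => by
      filter_upwards [hinv g] with x hx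
      change (f (g * x) ∈ U) = (f x ∈ U)
      rw [hx]
  exact Filter.eventuallyConst_set.1 h

/-! ### The orbit as a compact quotient of `K_n` -/

theorem continuous_orbitMap (n ℓ : ℕ) [NeZero ℓ] (lam : Fin n → ℂ) :
    Continuous (orbitMap n ℓ lam) :=
  Continuous.subtype_mk (continuous_id.smul continuous_const) _

theorem surjective_orbitMap (n ℓ : ℕ) [NeZero ℓ] (lam : Fin n → ℂ) :
    Function.Surjective (orbitMap n ℓ lam) := by
  rintro ⟨_, g, rfl⟩
  exact ⟨g, rfl⟩

/-- A continuous map from a compact space to a Hausdorff one is closed. Continuity on the orbit can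
thus be tested on `K_n`. -/
theorem isQuotientMap_orbitMap (n ℓ : ℕ) [NeZero ℓ] (lam : Fin n → ℂ) :
    Topology.IsQuotientMap (orbitMap n ℓ lam) :=
  (continuous_orbitMap n ℓ lam).isClosedMap.isQuotientMap (continuous_orbitMap n ℓ lam)
    (surjective_orbitMap n ℓ lam)

theorem orbitMap_mul {n ℓ : ℕ} [NeZero ℓ] (lam : Fin n → ℂ) (g h : KGroup n ℓ) :
    orbitMap n ℓ lam (g * h) = g • orbitMap n ℓ lam h :=
  Subtype.ext (mul_smul g h (DeltaOp n ℓ lam))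

theorem orbitMap_eq_iff {n ℓ : ℕ} [NeZero ℓ] (lam : Fin n → ℂ) (g h : KGroup n ℓ) :
    orbitMap n ℓ lam g = orbitMap n ℓ lam h ↔
      (h⁻¹ * g) • DeltaOp n ℓ lam = DeltaOp n ℓ lam := by
  rw [mul_smul, inv_smul_eq_iff]
  exact Subtype.ext_iff

instance instCompactSpaceOrbit (n ℓ : ℕ) [NeZero ℓ] (lam : Fin n → ℂ) :
    CompactSpace (Orbit n ℓ lam) :=
  ⟨by rw [← (surjective_orbitMap n ℓ lam).range_eq]
      exact isCompact_range (continuous_orbitMap n ℓ lam)⟩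

instance instIsFiniteMeasureOrbitMeasure (n ℓ : ℕ) [NeZero ℓ] (μ : Measure (KGroup n ℓ))
    [μ.IsHaarMeasure] (lam : Fin n → ℂ) : IsFiniteMeasure (orbitMeasure n ℓ μ lam) :=
  inferInstanceAs (IsFiniteMeasure (μ.map (orbitMap n ℓ lam)))

instance instIsOpenPosMeasureOrbitMeasure (n ℓ : ℕ) [NeZero ℓ] (μ : Measure (KGroup n ℓ))
    [μ.IsHaarMeasure] (lam : Fin n → ℂ) : (orbitMeasure n ℓ μ lam).IsOpenPosMeasure :=
  (continuous_orbitMap n ℓ lam).isOpenPosMeasure_map (surjective_orbitMap n ℓ lam)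

/-! ### Existence -/

theorem rhoKC_zeroWeight_eq_of_orbitMap_eq {n ℓ : ℕ} [NeZero ℓ] (k : ℕ) {C : Fin ℓ → ℤ}
    (hC : ∑ i, C i = 0) {lam : Fin n → ℂ} (hlam : lam ∈ LambdaReg n ℓ) {g h : KGroup n ℓ}
    (hgh : orbitMap n ℓ lam g = orbitMap n ℓ lam h) :
    rhoKC n ℓ k C g (zeroWeight n k) = rhoKC n ℓ k C h (zeroWeight n k) := by
  have h1 := rhoKC_zeroWeight_of_smul_deltaOp k hC hlam ((orbitMap_eq_iff lam g h).1 hgh)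
  conv_rhs => rw [← h1]
  rw [← Module.End.mul_apply, ← map_mul, mul_inv_cancel_left]

/-- The continuous function `g · Δ^op(λ) ↦ φ(g · (y_1 ⋯ y_n)^k)` on the orbit. -/
def matrixCoeff {n ℓ : ℕ} [NeZero ℓ] (k : ℕ) {C : Fin ℓ → ℤ} (hC : ∑ i, C i = 0)
    {lam : Fin n → ℂ} (hlam : lam ∈ LambdaReg n ℓ) (φ : Module.Dual ℂ (W n k)) :
    C(Orbit n ℓ lam, ℂ) where
  toFun B := φ (rhoKC n ℓ k C (Function.surjInv (surjective_orbitMap n ℓ lam) B)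
    (zeroWeight n k))
  continuous_toFun := by
    rw [(isQuotientMap_orbitMap n ℓ lam).continuous_iff]
    refine (continuous_dual_rhoKC k C φ (zeroWeight n k)).congr fun g => ?_
    exact congrArg φ (rhoKC_zeroWeight_eq_of_orbitMap_eq k hC hlam
      (Function.surjInv_eq (surjective_orbitMap n ℓ lam) _)).symm

theorem matrixCoeff_orbitMap {n ℓ : ℕ} [NeZero ℓ] (k : ℕ) {C : Fin ℓ → ℤ} (hC : ∑ i, C i = 0)
    {lam : Fin n → ℂ} (hlam : lam ∈ LambdaReg n ℓ) (φ : Module.Dual ℂ (W n k))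
    (g : KGroup n ℓ) :
    matrixCoeff k hC hlam φ (orbitMap n ℓ lam g) = φ (rhoKC n ℓ k C g (zeroWeight n k)) :=
  congrArg φ (rhoKC_zeroWeight_eq_of_orbitMap_eq k hC hlam
    (Function.surjInv_eq (surjective_orbitMap n ℓ lam) _))

/-- The linear map `φ ↦ matrixCoeff φ`. -/
def matrixCoeffₗ {n ℓ : ℕ} [NeZero ℓ] (k : ℕ) {C : Fin ℓ → ℤ} (hC : ∑ i, C i = 0)
    {lam : Fin n → ℂ} (hlam : lam ∈ LambdaReg n ℓ) :
    Module.Dual ℂ (W n k) →ₗ[ℂ] C(Orbit n ℓ lam, ℂ) where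
  toFun := matrixCoeff k hC hlam
  map_add' _ _ := rfl
  map_smul' _ _ := rfl

/-- The intertwining map `W_{k,c}^∨ → L²(O_λ)` given by matrix coefficients. -/
def matrixCoeffIntertwining {n ℓ : ℕ} [NeZero ℓ] (k : ℕ) {C : Fin ℓ → ℤ} (hC : ∑ i, C i = 0)
    (μ : Measure (KGroup n ℓ)) [μ.IsHaarMeasure] {lam : Fin n → ℂ}
    (hlam : lam ∈ LambdaReg n ℓ) :
    Representation.IntertwiningMap (rhoKC n ℓ k C).dual (orbitL2Rep n ℓ μ lam) where
  toLinearMap := (ContinuousMap.toLp 2 (orbitMeasure n ℓ μ lam) ℂ).toLinearMap ∘ₗ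
    matrixCoeffₗ k hC hlam
  isIntertwining' g := by
    ext1 φ
    apply Lp.ext
    refine (ContinuousMap.coeFn_toLp _ _).trans ?_
    refine Filter.EventuallyEq.trans ?_ (Lp.coeFn_compMeasurePreserving _
      (measurePreserving_orbit n ℓ μ lam g⁻¹)).symm
    refine Filter.EventuallyEq.trans (Filter.Eventually.of_forall fun B => ?_)
      ((measurePreserving_orbit n ℓ μ lam g⁻¹).quasiMeasurePreserving.ae_eq_comp
        (ContinuousMap.coeFn_toLp _ _).symm)
    obtain ⟨h, rfl⟩ := surjective_orbitMap n ℓ lam B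
    change matrixCoeff k hC hlam ((rhoKC n ℓ k C).dual g φ) (orbitMap n ℓ lam h) =
      matrixCoeff k hC hlam φ (g⁻¹ • orbitMap n ℓ lam h)
    rw [← orbitMap_mul, matrixCoeff_orbitMap, matrixCoeff_orbitMap, map_mul]
    rfl

theorem coeFn_matrixCoeffIntertwining {n ℓ : ℕ} [NeZero ℓ] (k : ℕ) {C : Fin ℓ → ℤ}
    (hC : ∑ i, C i = 0) (μ : Measure (KGroup n ℓ)) [μ.IsHaarMeasure] {lam : Fin n → ℂ}
    (hlam : lam ∈ LambdaReg n ℓ) (φ : Module.Dual ℂ (W n k)) :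
    matrixCoeffIntertwining k hC μ hlam φ =ᵐ[orbitMeasure n ℓ μ lam] matrixCoeff k hC hlam φ :=
  ContinuousMap.coeFn_toLp _ _

/-- The orbit measure charges open sets, so a continuous function that is zero in `L²` vanishes
everywhere; then `φ` kills all translates of `v`. -/
theorem injective_matrixCoeffIntertwining {n ℓ : ℕ} [NeZero ℓ] (k : ℕ) {C : Fin ℓ → ℤ}
    (hC : ∑ i, C i = 0) (μ : Measure (KGroup n ℓ)) [μ.IsHaarMeasure] {lam : Fin n → ℂ}
    (hlam : lam ∈ LambdaReg n ℓ) :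
    Function.Injective (matrixCoeffIntertwining k hC μ hlam) := by
  rw [injective_iff_map_eq_zero]
  intro φ hφ
  have h : matrixCoeff k hC hlam φ = 0 :=
    ContinuousMap.toLp_injective (p := 2) (𝕜 := ℂ) (orbitMeasure n ℓ μ lam)
      (hφ.trans (map_zero _).symm)
  exact eq_zero_of_forall_rhoKC_zeroWeight fun g =>
    (matrixCoeff_orbitMap k hC hlam φ g).symm.trans (by rw [h]; rfl)

/-! ### Uniqueness -/

instance instFiniteW (n k : ℕ) : Module.Finite ℂ (W n k) :=
  Module.Finite.iff_fg.2 (homogeneousSubmodule_fg _ _ (k * n))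

/-- Pulled back to `K_n`, an intertwining map is given almost everywhere by matrix coefficients. -/
theorem exists_ae_eq_dual_rhoKC {n ℓ : ℕ} [NeZero ℓ] {k : ℕ} {C : Fin ℓ → ℤ}
    {μ : Measure (KGroup n ℓ)} [μ.IsHaarMeasure] {lam : Fin n → ℂ}
    (η : Representation.IntertwiningMap (rhoKC n ℓ k C).dual (orbitL2Rep n ℓ μ lam)) :
    ∃ (Φ : Orbit n ℓ lam → W n k) (w : W n k),
      (∀ φ, ∀ᵐ x ∂μ, η φ (orbitMap n ℓ lam x) = φ (Φ (orbitMap n ℓ lam x))) ∧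
      ∀ᵐ x ∂μ, Φ (orbitMap n ℓ lam x) = rhoKC n ℓ k C x w := by
  let b := Module.finBasis ℂ (W n k)
  -- Chosen representatives of the finitely many `η (b.coord j)` are assembled into one `W_k`-valued
  -- function.
  let Φ : Orbit n ℓ lam → W n k := fun B => ∑ j, η (b.coord j) B • b j
  have hq : Measure.QuasiMeasurePreserving (orbitMap n ℓ lam) μ (orbitMeasure n ℓ μ lam) :=
    (measurable_orbitMap n ℓ lam).quasiMeasurePreserving μ
  have hΦ (φ : Module.Dual ℂ (W n k)) :
      ∀ᵐ B ∂orbitMeasure n ℓ μ lam, η φ B = φ (Φ B) := by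
    have hsum : η φ = ∑ j, φ (b j) • η (b.coord j) := by
      conv_lhs => rw [← b.sum_dual_apply_smul_coord φ]
      simp only [map_sum, map_smul]
    have hall : ∀ᵐ B ∂orbitMeasure n ℓ μ lam,
        (∑ j, φ (b j) • η (b.coord j) : Lp ℂ 2 (orbitMeasure n ℓ μ lam)) B =
          ∑ j, φ (b j) • η (b.coord j) B := by
      filter_upwards [Lp.coeFn_finsetSum Finset.univ fun j => φ (b j) • η (b.coord j),
        ae_all_iff.2 fun j => Lp.coeFn_smul (φ (b j)) (η (b.coord j))] with B h1 h2
      rw [h1, Finset.sum_apply]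
      exact Finset.sum_congr rfl fun j _ => h2 j
    filter_upwards [hall] with B hB
    rw [hsum, hB]
    simp only [Φ, map_sum, map_smul, smul_eq_mul]
    exact Finset.sum_congr rfl fun j _ => mul_comm _ _
  have hequiv (g : KGroup n ℓ) : ∀ᵐ x ∂μ,
      Φ (orbitMap n ℓ lam (g * x)) = rhoKC n ℓ k C g (Φ (orbitMap n ℓ lam x)) := by
    have h1 (j) : ∀ᵐ x ∂μ, b.coord j (Φ (orbitMap n ℓ lam (g * x))) =
        b.coord j (rhoKC n ℓ k C g (Φ (orbitMap n ℓ lam x))) := by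
      have h2 := hq.ae (hΦ (b.coord j))
      have h3 := (measurePreserving_mul_left μ g).quasiMeasurePreserving.ae h2
      -- The dual action of `g⁻¹` is precomposition with `rhoKC g`.
      have h4 := hq.ae (hΦ ((rhoKC n ℓ k C).dual g⁻¹ (b.coord j)))
      have h5 := hq.ae (Lp.coeFn_compMeasurePreserving (η (b.coord j))
        (measurePreserving_orbit n ℓ μ lam g⁻¹⁻¹))
      filter_upwards [h3, h4, h5] with x h3 h4 h5
      rw [← h3, orbitMap_mul]
      rw [η.isIntertwining] at h4
      have h6 := h5.symm.trans h4
      simp only [Function.comp_apply, inv_inv, Representation.dual_apply] at h6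
      exact h6
    filter_upwards [ae_all_iff.2 h1] with x hx
    exact b.ext_elem hx
  -- Untwisting by `x⁻¹` turns equivariance of `Φ` into left invariance; the almost-everywhere
  -- constant value is `w`.
  let Ψ : KGroup n ℓ → W n k := fun x => rhoKC n ℓ k C x⁻¹ (Φ (orbitMap n ℓ lam x))
  have hconst (i) : ∃ a : ℂ, ∀ᵐ x ∂μ, b.coord i (Ψ x) = a := by
    refine exists_ae_eq_const_of_forall_mul_left μ ?_ fun g => ?_
    · simp only [Ψ, Φ, map_sum, map_smul, smul_eq_mul]
      refine Finset.measurable_sum _ fun j _ => Measurable.mul ?_ ?_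
      · exact (Lp.stronglyMeasurable _).measurable.comp (measurable_orbitMap n ℓ lam)
      · exact ((continuous_dual_rhoKC k C (b.coord i) (b j)).comp continuous_inv).measurable
    · filter_upwards [hequiv g] with x hx
      simp only [Ψ]
      rw [hx, ← Module.End.mul_apply, ← map_mul, mul_inv_rev, inv_mul_cancel_right]
  choose a ha using hconst
  refine ⟨Φ, ∑ i, a i • b i, fun φ => hq.ae (hΦ φ), ?_⟩
  filter_upwards [ae_all_iff.2 ha] with x hx
  have h : Ψ x = ∑ i, a i • b i := by
    rw [← b.sum_repr (Ψ x)]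
    exact Finset.sum_congr rfl fun i _ => congrArg (· • b i) (hx i)
  rw [← h, ← Module.End.mul_apply, ← map_mul, mul_inv_cancel, map_one, Module.End.one_apply]

theorem exists_eq_smul_matrixCoeffIntertwining {n ℓ : ℕ} [NeZero ℓ] {k : ℕ} {C : Fin ℓ → ℤ}
    (hC : ∑ i, C i = 0) {μ : Measure (KGroup n ℓ)} [μ.IsHaarMeasure] {lam : Fin n → ℂ}
    (hlam : lam ∈ LambdaReg n ℓ)
    (η : Representation.IntertwiningMap (rhoKC n ℓ k C).dual (orbitL2Rep n ℓ μ lam)) :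
    ∃ a : ℂ, η = a • matrixCoeffIntertwining k hC μ hlam := by
  obtain ⟨Φ, w, hΦ, hw⟩ := exists_ae_eq_dual_rhoKC η
  obtain ⟨a, rfl⟩ : ∃ a : ℂ, w = a • zeroWeight n k := by
    refine exists_eq_smul_zeroWeight (ℓ := ℓ) hC fun t ht => ?_
    set τ : KGroup n ℓ := fun _ => diagUnitary t ht
    -- Two conull sets meet, so the formula for `Φ` holds at some `x` and at `x * τ` at once. These
    -- have the same image in the orbit, whence `τ · w = w`.
    have h := hw.and ((quasiMeasurePreserving_mul_right μ τ).ae hw)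
    obtain ⟨x, hx, hxt⟩ := h.exists
    have hπ : orbitMap n ℓ lam (x * τ) = orbitMap n ℓ lam x := by
      rw [orbitMap_eq_iff, inv_mul_cancel_left]
      exact const_diagUnitary_smul_deltaOp lam t ht
    rw [hπ, hx, map_mul, Module.End.mul_apply] at hxt
    have h' := congrArg (rhoKC n ℓ k C x⁻¹) hxt
    simpa only [← Module.End.mul_apply, ← map_mul, inv_mul_cancel_left, inv_mul_cancel, map_one,
      Module.End.one_apply] using h'.symm
  refine ⟨a, ?_⟩
  apply Representation.IntertwiningMap.ext
  ext1 φ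
  apply Lp.ext
  change η φ =ᵐ[_] (a • matrixCoeffIntertwining k hC μ hlam φ : Lp ℂ 2 (orbitMeasure n ℓ μ lam))
  refine Filter.EventuallyEq.trans ?_ (Lp.coeFn_smul _ _).symm
  refine Filter.EventuallyEq.trans (g := a • ⇑(matrixCoeff k hC hlam φ)) ?_
    ((coeFn_matrixCoeffIntertwining k hC μ hlam φ).const_smul a).symm
  refine (ae_map_iff (measurable_orbitMap n ℓ lam).aemeasurable (measurableSet_eq_fun
    (Lp.stronglyMeasurable _).measurable
    ((matrixCoeff k hC hlam φ).continuous.measurable.const_smul a))).2 ?_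
  filter_upwards [hΦ φ, hw] with x h1 h2
  rw [h1, h2, map_smul, map_smul, Pi.smul_apply, matrixCoeff_orbitMap]

end CyclicQuiver

end

theorem mainTheorem5 (n ℓ : ℕ) [NeZero ℓ] (ε : ℂ) (hε : IsPrimitiveRoot ε ℓ)
    (k : ℕ) (c : Fin (ℓ - 1) → ℂ) (C : Fin ℓ → ℤ)
    (hC : ∀ i, (C i : ℂ) = CyclicQuiver.paramC ℓ ε c i)
    (μ : MeasureTheory.Measure (CyclicQuiver.KGroup n ℓ)) [μ.IsHaarMeasure]
    (lam : Fin n → ℂ) (hlam : lam ∈ CyclicQuiver.LambdaReg n ℓ) :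
    ∃ η : Representation.IntertwiningMap (CyclicQuiver.rhoKC n ℓ k C).dual
        (CyclicQuiver.orbitL2Rep n ℓ μ lam),
      Function.Injective η ∧
        ∀ η' : Representation.IntertwiningMap (CyclicQuiver.rhoKC n ℓ k C).dual
            (CyclicQuiver.orbitL2Rep n ℓ μ lam),
          ∃ a : ℂ, η' = a • η := by
  have h0 := CyclicQuiver.sum_eq_zero_of_eq_paramC hε hC
  exact ⟨CyclicQuiver.matrixCoeffIntertwining k h0 μ hlam,
    CyclicQuiver.injective_matrixCoeffIntertwining k h0 μ hlam,
    CyclicQuiver.exists_eq_smul_matrixCoeffIntertwining h0 hlam⟩
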